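/- Conventions. A \emph{complex vector lattice} is a complexification $X_{\mathbb C}=X\oplus iX$ of a real vector lattice $X$ in which the modulus $|x+iy|=\sup_{\theta\in[0,2\pi]}(x\cos\theta+y\sin\theta)$ exists in $X$ for all $x,y\in X$; it is called Archimedean if $X$ is Archimedean. A \emph{complex vector lattice homomorphism} is a $\mathbb C$-linear map $T:X_{\mathbb C}\to Y_{\mathbb C}$ between complex vector lattices with $T|z|=|Tz|$ for all $z\in X_{\mathbb C}$. A \emph{complex vector sublattice} of $X_{\mathbb C}$ is a complex linear subspace that is invariant under conjugation $x+iy\mapsto x-iy$ and contains $|z|$ whenever it contains $z$; it has the form $E\oplus iE$ for a real vector sublattice $E$ of $X$, and it is itself a complex vector lattice, with the same modulus. A \emph{free complex vector lattice} over a set $A$ is a complex vector lattice $F_{\mathbb C}$ with a map $\iota:A\to F_{\mathbb C}$ such that for every complex vector lattice $V_{\mathbb C}$ and every map $T:A\to V_{\mathbb C}$ there is a unique complex vector lattice homomorphism $\hat T:F_{\mathbb C}\to V_{\mathbb C}$ with $\hat T\circ\iota=T$. A \emph{free Archimedean complex vector lattice} over $A$ is an Archimedean $F_{\mathbb C}$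 with a map $\iota:A\to F_{\mathbb C}$ that has this property for all Archimedean $V_{\mathbb C}$. Proposition. Let $A$ be a non-empty set. (1) A free complex vector lattice over $A$ exists. (2) Let $\pm A=A\sqcup\{-x:x\in A\}$ be the disjoint union of $A$ and a set of formal negatives, and for $p,q\in\pm A$ let $\eta_{(p,q)}:\mathbb R^{\pm A\times\pm A}\to\mathbb R$ be the coordinate function $\eta_{(p,q)}(f)=f(p,q)$. Let $\mathcal F$ be the vector lattice of all functions $\mathbb R^{\pm A\times\pm A}\to\mathbb R$ with the pointwise order. The complex vector sublattice of $\mathcal F\oplus i\mathcal F$ generated by the elements $\eta_{(x,x)}+i\eta_{(-x,x)}$, $x\in A$, together with the map $\iota(x)=\eta_{(x,x)}+i\eta_{(-x,x)}$, is the free Archimedean complex vector lattice over $A$. -/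

import Mathlib

universe u v

/-- The complexification `X ⊕ iX` of a real vector space `X`; `⟨x, y⟩` stands for `x + iy`. -/
@[ext]
structure Cplx (X : Type*) where
  re : X
  im : X

namespace Cplx

section Algebra

variable {X : Type*} [AddCommGroup X]

instance : Zero (Cplx X) := ⟨⟨0, 0⟩⟩
instance : Add (Cplx X) := ⟨fun z w => ⟨z.re + w.re, z.im + w.im⟩⟩
instance : Neg (Cplx X) := ⟨fun z => ⟨-z.re, -z.im⟩⟩

@[simp] theorem zero_re : (0 : Cplx X).re = 0 := rfl
@[simp] theorem zero_im : (0 : Cplx X).im = 0 := rfl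
@[simp] theorem add_re (z w : Cplx X) : (z + w).re = z.re + w.re := rfl
@[simp] theorem add_im (z w : Cplx X) : (z + w).im = z.im + w.im := rfl
@[simp] theorem neg_re (z : Cplx X) : (-z).re = -z.re := rfl
@[simp] theorem neg_im (z : Cplx X) : (-z).im = -z.im := rfl

instance : AddCommGroup (Cplx X) where
  add_assoc a b c := by ext <;> simp [add_assoc]
  zero_add a := by ext <;> simp
  add_zero a := by ext <;> simp
  add_comm a b := by ext <;> simp [add_comm]
  neg_add_cancel a := by ext <;> simp
  nsmul := nsmulRec
  zsmul := zsmulRec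

variable [Module ℝ X]

instance : SMul ℂ (Cplx X) :=
  ⟨fun c z => ⟨c.re • z.re - c.im • z.im, c.re • z.im + c.im • z.re⟩⟩

@[simp] theorem smul_re (c : ℂ) (z : Cplx X) : (c • z).re = c.re • z.re - c.im • z.im := rfl
@[simp] theorem smul_im (c : ℂ) (z : Cplx X) : (c • z).im = c.re • z.im + c.im • z.re := rfl

instance : Module ℂ (Cplx X) where
  one_smul z := by ext <;> simp
  mul_smul c d z := by ext <;> simp <;> module
  smul_zero c := by ext <;> simp
  smul_add c z w := by ext <;> simp <;> module
  add_smul c d z := by ext <;> simp <;> module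
  zero_smul z := by ext <;> simp

/-- The inclusion of `X` in `X ⊕ iX`, sending `x` to `x + i0`. -/
def ofReal (x : X) : Cplx X := ⟨x, 0⟩

/-- Conjugation, sending `x + iy` to `x - iy`. -/
def conj (z : Cplx X) : Cplx X := ⟨z.re, -z.im⟩

/-- The set `{x cos θ + y sin θ : θ ∈ [0, 2π]}`, for `z = x + iy`. -/
def rotations (z : Cplx X) : Set X :=
  (fun θ : ℝ => Real.cos θ • z.re + Real.sin θ • z.im) '' Set.Icc 0 (2 * Real.pi)

end Algebra

end Cplx

/-- `X` is a real vector lattice in which `sup {x cos θ + y sin θ : θ ∈ [0, 2π]}` exists for all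
`x` and `y`, that is, the complexification `X ⊕ iX` is a complex vector lattice. -/
class IsComplexVectorLattice (X : Type*) [AddCommGroup X] [Lattice X] [Module ℝ X] : Prop
    extends IsOrderedAddMonoid X, IsOrderedModule ℝ X where
  exists_modulus : ∀ z : Cplx X, ∃ m : X, IsLUB z.rotations m

/-- The real vector lattice `X` is Archimedean: if `n x ≤ y` for all `n`, then `x ≤ 0`. -/
def IsArchimedeanVL (X : Type*) [AddCommGroup X] [Lattice X] : Prop :=
  ∀ x y : X, (∀ n : ℕ, n • x ≤ y) → x ≤ 0

section Modulus

variable {X : Type*} [AddCommGroup X] [Lattice X] [Module ℝ X] [IsComplexVectorLattice X]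

/-- The modulus `|x + iy| = sup {x cos θ + y sin θ : θ ∈ [0, 2π]}`. -/
noncomputable def Cplx.modulus (z : Cplx X) : X :=
  (IsComplexVectorLattice.exists_modulus z).choose

theorem Cplx.isLUB_modulus (z : Cplx X) : IsLUB z.rotations z.modulus :=
  (IsComplexVectorLattice.exists_modulus z).choose_spec

theorem Cplx.modulus_ofReal (x : X) : (Cplx.ofReal x).modulus = |x| := by
  refine (Cplx.isLUB_modulus _).unique ⟨?_, ?_⟩
  · rintro _ ⟨θ, -, rfl⟩
    simp only [Cplx.ofReal, smul_zero, add_zero]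
    have h1 : 0 ≤ 1 - Real.cos θ := by linarith [Real.cos_le_one θ]
    have h2 : 0 ≤ 1 + Real.cos θ := by linarith [Real.neg_one_le_cos θ]
    have h3 := add_le_add
      (smul_le_smul_of_nonneg_left (le_abs_self x) h2)
      (smul_le_smul_of_nonneg_left (neg_le_abs x) h1)
    have h4 := smul_le_smul_of_nonneg_left h3 (by norm_num : (0 : ℝ) ≤ 1 / 2)
    convert h4 using 1 <;> module
  · intro m hm
    refine sup_le ?_ ?_
    · have := hm ⟨0, ⟨le_rfl, by positivity⟩, rfl⟩
      simpa [Cplx.ofReal] using this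
    · have := hm ⟨Real.pi, ⟨by positivity, by linarith [Real.pi_pos]⟩, rfl⟩
      simpa [Cplx.ofReal] using this

end Modulus

/-- A complex vector lattice homomorphism `X ⊕ iX → Y ⊕ iY`: a `ℂ`-linear map that preserves the
modulus, `T |z| = |T z|`. -/
structure CVLHom (X Y : Type*) [AddCommGroup X] [Lattice X] [Module ℝ X] [IsComplexVectorLattice X]
    [AddCommGroup Y] [Lattice Y] [Module ℝ Y] [IsComplexVectorLattice Y]
    extends Cplx X →ₗ[ℂ] Cplx Y where
  map_modulus : ∀ z : Cplx X, toFun (Cplx.ofReal z.modulus) = Cplx.ofReal (toFun z).modulus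

/-- The universal property of the free complex vector lattice `(X ⊕ iX, ι)` over `A`, tested on all
complex vector lattices in the universe `v`. -/
def IsFreeCVL {A : Type*} {X : Type*} [AddCommGroup X] [Lattice X] [Module ℝ X]
    [IsComplexVectorLattice X] (ι : A → Cplx X) : Prop :=
  ∀ (V : Type v) [AddCommGroup V] [Lattice V] [Module ℝ V] [IsComplexVectorLattice V]
    (T : A → Cplx V), ∃! S : CVLHom X V, ∀ a, S.toLinearMap (ι a) = T a

/-- The pair `(X ⊕ iX, ι)` is the free Archimedean complex vector lattice over `A`: `X` is
Archimedean, and the universal property holds for all Archimedean complex vector lattices in the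
universe `v`. -/
def IsFreeArchimedeanCVL {A : Type*} {X : Type*} [AddCommGroup X] [Lattice X] [Module ℝ X]
    [IsComplexVectorLattice X] (ι : A → Cplx X) : Prop :=
  IsArchimedeanVL X ∧
  ∀ (V : Type v) [AddCommGroup V] [Lattice V] [Module ℝ V] [IsComplexVectorLattice V],
    IsArchimedeanVL V →
    ∀ T : A → Cplx V, ∃! S : CVLHom X V, ∀ a, S.toLinearMap (ι a) = T a

/-- A complex vector sublattice of `X ⊕ iX`: a conjugation invariant complex subspace which
contains `|z|` whenever it contains `z`. -/
structure ComplexSublattice (X : Type*) [AddCommGroup X] [Lattice X] [Module ℝ X]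
    [IsComplexVectorLattice X] extends Submodule ℂ (Cplx X) where
  conj_mem : ∀ z, z ∈ toSubmodule → z.conj ∈ toSubmodule
  modulus_mem : ∀ z, z ∈ toSubmodule → Cplx.ofReal z.modulus ∈ toSubmodule

section Generated

variable {X : Type*} [AddCommGroup X] [Lattice X] [Module ℝ X] [IsComplexVectorLattice X]

/-- The smallest complex vector sublattice of `X ⊕ iX` that contains `S`. -/
def latC (S : Set (Cplx X)) : ComplexSublattice X where
  toSubmodule := sInf {p | ∃ L : ComplexSublattice X, S ⊆ L.toSubmodule ∧ p = L.toSubmodule}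
  conj_mem z hz := by
    simp only [Submodule.mem_sInf] at hz ⊢
    rintro _ ⟨L, hL, rfl⟩
    exact L.conj_mem z (hz _ ⟨L, hL, rfl⟩)
  modulus_mem z hz := by
    simp only [Submodule.mem_sInf] at hz ⊢
    rintro _ ⟨L, hL, rfl⟩
    exact L.modulus_mem z (hz _ ⟨L, hL, rfl⟩)

theorem subset_latC (S : Set (Cplx X)) : S ⊆ (latC S).toSubmodule := by
  intro z hz
  simp only [latC, SetLike.mem_coe, Submodule.mem_sInf]
  rintro _ ⟨L, hL, rfl⟩
  exact hL hz

namespace ComplexSublattice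

variable (L : ComplexSublattice X)

/-- The real part `E` of a complex vector sublattice `L`, for which `L = E ⊕ iE`. -/
def realPart : Submodule ℝ X where
  carrier := {x | Cplx.ofReal x ∈ L.toSubmodule}
  zero_mem' := L.zero_mem
  add_mem' {x y} hx hy := by
    have h := L.add_mem hx hy
    have e : Cplx.ofReal x + Cplx.ofReal y = Cplx.ofReal (x + y) := by
      ext <;> simp [Cplx.ofReal]
    rwa [e] at h
  smul_mem' c x hx := by
    have h := L.smul_mem (c : ℂ) hx
    have e : (c : ℂ) • Cplx.ofReal x = Cplx.ofReal (c • x) := by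
      ext <;> simp [Cplx.ofReal, -Complex.coe_smul]
    rwa [e] at h

variable {L}

theorem abs_mem {x : X} (hx : x ∈ L.realPart) : |x| ∈ L.realPart := by
  have h := L.modulus_mem _ hx
  rwa [Cplx.modulus_ofReal] at h

theorem re_mem {z : Cplx X} (hz : z ∈ L.toSubmodule) : z.re ∈ L.realPart := by
  have h := L.smul_mem (1 / 2 : ℂ) (L.add_mem hz (L.conj_mem z hz))
  have e : (1 / 2 : ℂ) • (z + z.conj) = Cplx.ofReal z.re := by
    ext
    · simp [Cplx.ofReal, Cplx.conj]
      module
    · simp [Cplx.ofReal, Cplx.conj]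
  rwa [e] at h

theorem im_mem {z : Cplx X} (hz : z ∈ L.toSubmodule) : z.im ∈ L.realPart := by
  have h := re_mem (L.smul_mem (-Complex.I) hz)
  simpa using h

theorem mem_iff {z : Cplx X} :
    z ∈ L.toSubmodule ↔ z.re ∈ L.realPart ∧ z.im ∈ L.realPart := by
  refine ⟨fun h => ⟨re_mem h, im_mem h⟩, fun ⟨h1, h2⟩ => ?_⟩
  have h := L.add_mem h1 (L.smul_mem Complex.I h2)
  have e : Cplx.ofReal z.re + Complex.I • Cplx.ofReal z.im = z := by
    ext <;> simp [Cplx.ofReal]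
  rwa [e] at h

theorem sup_mem {x y : X} (hx : x ∈ L.realPart) (hy : y ∈ L.realPart) :
    x ⊔ y ∈ L.realPart := by
  have h := L.realPart.smul_mem (1 / 2 : ℝ)
    (L.realPart.add_mem (L.realPart.add_mem hx hy) (abs_mem (L.realPart.sub_mem hy hx)))
  have e : (1 / 2 : ℝ) • (x + y + |y - x|) = x ⊔ y := by
    rw [← two_nsmul_sup_eq_add_add_abs_sub, ← Nat.cast_smul_eq_nsmul ℝ, smul_smul]
    norm_num
  rwa [e] at h

theorem inf_mem {x y : X} (hx : x ∈ L.realPart) (hy : y ∈ L.realPart) :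
    x ⊓ y ∈ L.realPart := by
  have h := L.realPart.neg_mem (sup_mem (L.realPart.neg_mem hx) (L.realPart.neg_mem hy))
  rwa [neg_sup, neg_neg, neg_neg] at h

/-- The order on the real part is inherited from `X`, and so are the lattice operations. -/
instance : Lattice L.realPart :=
  Subtype.lattice (fun _ _ hx hy => sup_mem hx hy) (fun _ _ hx hy => inf_mem hx hy)

instance : IsComplexVectorLattice L.realPart where
  add_le_add_left a b h c := add_le_add_left (α := X) h c
  smul_le_smul_of_nonneg_left c hc a b h := smul_le_smul_of_nonneg_left (β := X) h hc
  smul_le_smul_of_nonneg_right a ha c d h := smul_le_smul_of_nonneg_right (β := X) h ha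
  exists_modulus z := by
    have hz : (⟨z.re, z.im⟩ : Cplx X) ∈ L.toSubmodule := mem_iff.2 ⟨z.re.2, z.im.2⟩
    have hm := Cplx.isLUB_modulus (⟨z.re, z.im⟩ : Cplx X)
    refine ⟨⟨_, L.modulus_mem _ hz⟩, ?_, ?_⟩
    · rintro _ ⟨θ, hθ, rfl⟩
      exact hm.1 ⟨θ, hθ, rfl⟩
    · intro m hm'
      refine hm.2 ?_
      rintro _ ⟨θ, hθ, rfl⟩
      exact hm' ⟨θ, hθ, rfl⟩

/-- An element `z` of `L`, as an element of `E ⊕ iE`. -/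
def mk' (z : Cplx X) (hz : z ∈ L.toSubmodule) : Cplx L.realPart :=
  ⟨⟨z.re, re_mem hz⟩, ⟨z.im, im_mem hz⟩⟩

end ComplexSublattice

end Generated

section Functions

theorem real_isLUB_rotations (z : Cplx ℝ) :
    IsLUB z.rotations (Real.sqrt (z.re ^ 2 + z.im ^ 2)) := by
  refine ⟨?_, fun m hm => ?_⟩
  · rintro _ ⟨θ, -, rfl⟩
    refine Real.le_sqrt_of_sq_le ?_
    simp only [smul_eq_mul]
    nlinarith [sq_nonneg (Real.sin θ * z.re - Real.cos θ * z.im), Real.sin_sq_add_cos_sq θ]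
  · set w : ℂ := ⟨z.re, z.im⟩ with hw
    have hn : Real.sqrt (z.re ^ 2 + z.im ^ 2) = ‖w‖ := by
      rw [Complex.norm_def, Complex.normSq_apply, hw]
      simp only [sq]
    have key : ∀ θ : ℝ, Real.cos θ = Real.cos w.arg → Real.sin θ = Real.sin w.arg →
        θ ∈ Set.Icc 0 (2 * Real.pi) → ‖w‖ ≤ m := by
      intro θ hc hs hθ
      have h := hm ⟨θ, hθ, rfl⟩
      have h1 : z.re = ‖w‖ * Real.cos w.arg := (Complex.norm_mul_cos_arg w).symm
      have h2 : z.im = ‖w‖ * Real.sin w.arg := (Complex.norm_mul_sin_arg w).symm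
      simp only [smul_eq_mul, hc, hs] at h
      rw [h1, h2] at h
      have h3 := Real.sin_sq_add_cos_sq w.arg
      calc ‖w‖ = ‖w‖ * (Real.sin w.arg ^ 2 + Real.cos w.arg ^ 2) := by rw [h3, mul_one]
        _ = _ := by ring
        _ ≤ m := h
    rw [hn]
    by_cases h0 : 0 ≤ w.arg
    · exact key w.arg rfl rfl ⟨h0, by linarith [Complex.arg_le_pi w, Real.pi_pos]⟩
    · refine key (w.arg + 2 * Real.pi) (Real.cos_add_two_pi _) (Real.sin_add_two_pi _) ⟨?_, ?_⟩
      · linarith [Complex.neg_pi_lt_arg w, Real.pi_pos]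
      · linarith

/-- The real functions on any set, with the pointwise operations and the pointwise order. -/
instance (K : Type*) : IsComplexVectorLattice (K → ℝ) where
  exists_modulus z := by
    refine ⟨fun k => Real.sqrt (z.re k ^ 2 + z.im k ^ 2), ?_⟩
    refine isLUB_pi.2 fun k => ?_
    have h := real_isLUB_rotations (⟨z.re k, z.im k⟩ : Cplx ℝ)
    have e : Function.eval k '' z.rotations = (⟨z.re k, z.im k⟩ : Cplx ℝ).rotations := by
      simp only [Cplx.rotations, Set.image_image]
      rfl
    rw [e]
    exact h

end Functions

section Realization

variable (A : Type u)

/-- The set `±A`, the disjoint union of `A` and of a set of formal negatives: `Sum.inl x` stands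
for `x`, and `Sum.inr x` stands for `-x`. -/
abbrev Signed : Type u := A ⊕ A

variable {A}

/-- The coordinate function `η_(p,q)(f) = f(p,q)` on `ℝ^(±A × ±A)`. -/
def coordFun (p q : Signed A) : (Signed A × Signed A → ℝ) → ℝ := fun f => f (p, q)

/-- The element `η_(x,x) + i η_(-x,x)`. -/
def genElem (x : A) : Cplx ((Signed A × Signed A → ℝ) → ℝ) :=
  ⟨coordFun (Sum.inl x) (Sum.inl x), coordFun (Sum.inr x) (Sum.inl x)⟩

variable (A)

/-- The complex vector sublattice generated by the elements `η_(x,x) + i η_(-x,x)`, `x ∈ A`. -/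
def fvlC : ComplexSublattice ((Signed A × Signed A → ℝ) → ℝ) := latC (Set.range genElem)

variable {A}

/-- The map `x ↦ η_(x,x) + i η_(-x,x)`, with values in the generated sublattice. -/
def fvlIota (x : A) : Cplx (fvlC A).realPart :=
  ComplexSublattice.mk' (genElem x) (subset_latC _ ⟨x, rfl⟩)

end Realization

/-!
A complex vector lattice homomorphism is the complexification of a real linear map that preserves
moduli, so everything reduces to real subspaces closed under moduli.

The sublattice generated by a family indexed by `A` consists of values of formal expressions, hence
embeds in `Type u`. A product of sufficiently many test objects therefore contains a free complex
vector lattice, generated by the tautological family.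

In the Archimedean case, the real and imaginary parts of the generators of the concrete model are
linearly independent functionals on `Q = ℝ^(±A × ±A)`, so a map from `A` to `V ⊕ iV` extends to a
linear map `ψ : Dual ℝ Q → V`. By Gordan's theorem, if finitely many functionals `l` have a
pointwise minimum `≤ 0`, then `0` is a convex combination of them, and so the infimum of the `ψ l`
is `≤ 0` as well. Thus `d.1 ≤ 0` implies `d.2 ≤ 0` on the sublattice generated by the graph of `ψ`.
A modulus is a uniform limit of finite suprema of rotations, so the complex vector sublattice
generated by pairs from the graph lies in the uniform closure of that sublattice, where, as `V` is
Archimedean, `w.1 = 0` still implies `w.2 = 0`. It is therefore the graph of a map, which is the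
homomorphism sought.
-/

universe w

namespace Cplx

section Map

variable {X Y : Type*} [AddCommGroup X] [AddCommGroup Y]

theorem ofReal_add (x y : X) : ofReal (x + y) = ofReal x + ofReal y := by
  ext <;> simp [ofReal]

variable [Module ℝ X] [Module ℝ Y]

theorem ofReal_smul (c : ℝ) (x : X) : ofReal (c • x) = (c : ℂ) • ofReal x := by
  ext <;> simp [ofReal, -Complex.coe_smul]

theorem eq_ofReal_re_add_I_smul_ofReal_im (z : Cplx X) :
    z = ofReal z.re + Complex.I • ofReal z.im := by
  ext <;> simp [ofReal]

/-- The complexification `x + iy ↦ h x + i h y` of a real linear map `h`. -/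
def map (h : X →ₗ[ℝ] Y) : Cplx X →ₗ[ℂ] Cplx Y where
  toFun z := ⟨h z.re, h z.im⟩
  map_add' z w := by ext <;> simp
  map_smul' c z := by ext <;> simp

@[simp] theorem map_re (h : X →ₗ[ℝ] Y) (z : Cplx X) : (map h z).re = h z.re := rfl

@[simp] theorem map_im (h : X →ₗ[ℝ] Y) (z : Cplx X) : (map h z).im = h z.im := rfl

theorem image_rotations (h : X →ₗ[ℝ] Y) (z : Cplx X) :
    h '' z.rotations = (map h z).rotations := by
  simp only [rotations, Set.image_image, map_add, map_smul, map_re, map_im]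

theorem isLUB_image_rotations [Lattice Y] [IsComplexVectorLattice Y] (h : X →ₗ[ℝ] Y)
    (z : Cplx X) : IsLUB (h '' z.rotations) (map h z).modulus :=
  image_rotations h z ▸ isLUB_modulus _

end Map

end Cplx

section PreservesModulus

variable {X Y : Type*} [AddCommGroup X] [Lattice X] [Module ℝ X] [IsComplexVectorLattice X]
  [AddCommGroup Y] [Lattice Y] [Module ℝ Y] [IsComplexVectorLattice Y]

/-- A real linear map preserves the modulus if its complexification is a homomorphism of complex
vector lattices. -/
def PreservesModulus (h : X →ₗ[ℝ] Y) : Prop :=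
  ∀ z : Cplx X, h z.modulus = (Cplx.map h z).modulus

theorem preservesModulus_of_isLUB {h : X →ₗ[ℝ] Y}
    (hh : ∀ z : Cplx X, IsLUB (h '' z.rotations) (h z.modulus)) : PreservesModulus h :=
  fun z => (hh z).unique (z.isLUB_image_rotations h)

theorem preservesModulus_of_le_iff_le {e : X ≃ₗ[ℝ] Y} (he : ∀ x y, e x ≤ e y ↔ x ≤ y) :
    PreservesModulus e.toLinearMap :=
  let o : X ≃o Y := ⟨e.toEquiv, he _ _⟩
  preservesModulus_of_isLUB fun z => o.isLUB_image'.2 z.isLUB_modulus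

namespace PreservesModulus

/-- The homomorphism of complex vector lattices with real part `h`. -/
def toCVLHom {h : X →ₗ[ℝ] Y} (hh : PreservesModulus h) : CVLHom X Y where
  toLinearMap := Cplx.map h
  map_modulus z := Cplx.ext (hh z) (map_zero h)

end PreservesModulus

/-- A real subspace `E` of `X` is closed under moduli if `|x + iy| ∈ E` for all `x, y ∈ E`; these
are the real parts of the complex vector sublattices of `X ⊕ iX`. -/
def IsModulusClosed (E : Submodule ℝ X) : Prop :=
  ∀ ⦃z : Cplx X⦄, z.re ∈ E → z.im ∈ E → z.modulus ∈ E

theorem PreservesModulus.isModulusClosed_map {h : X →ₗ[ℝ] Y} (hh : PreservesModulus h)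
    {E : Submodule ℝ X} (hE : IsModulusClosed E) : IsModulusClosed (E.map h) := by
  rintro ⟨_, _⟩ ⟨x, hx, rfl⟩ ⟨y, hy, rfl⟩
  exact ⟨_, hE (z := ⟨x, y⟩) hx hy, hh _⟩

theorem PreservesModulus.isModulusClosed_eqLocus {h k : X →ₗ[ℝ] Y} (hh : PreservesModulus h)
    (hk : PreservesModulus k) : IsModulusClosed (LinearMap.eqLocus h k) := by
  intro z hre him
  have hz : Cplx.map h z = Cplx.map k z := Cplx.ext hre him
  rw [LinearMap.mem_eqLocus, hh, hk, hz]

end PreservesModulus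

namespace CVLHom

variable {X Y : Type*} [AddCommGroup X] [Lattice X] [Module ℝ X] [IsComplexVectorLattice X]
  [AddCommGroup Y] [Lattice Y] [Module ℝ Y] [IsComplexVectorLattice Y]

theorem toLinearMap_injective :
    Function.Injective (toLinearMap : CVLHom X Y → Cplx X →ₗ[ℂ] Cplx Y) := by
  rintro ⟨_, _⟩ ⟨_, _⟩ rfl
  rfl

/-- The restriction of a homomorphism of complex vector lattices to the real parts. -/
def restrictReal (S : CVLHom X Y) : X →ₗ[ℝ] Y where
  toFun x := (S.toLinearMap (Cplx.ofReal x)).re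
  map_add' x y := by rw [Cplx.ofReal_add, map_add, Cplx.add_re]
  map_smul' c x := by simp [Cplx.ofReal_smul, -Complex.coe_smul]

theorem map_ofReal (S : CVLHom X Y) (x : X) :
    S.toLinearMap (Cplx.ofReal x) = Cplx.ofReal (S.restrictReal x) := by
  have im_map_ofReal_abs (y : X) : (S.toLinearMap (Cplx.ofReal |y|)).im = 0 := by
    rw [← Cplx.modulus_ofReal]
    exact congrArg Cplx.im (S.map_modulus _)
  have hx : Cplx.ofReal x + Cplx.ofReal |x⁻| = Cplx.ofReal |x⁺| := by
    rw [← Cplx.ofReal_add, abs_of_nonneg (posPart_nonneg x), abs_of_nonneg (negPart_nonneg x),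
      ← sub_eq_iff_eq_add.1 (posPart_sub_negPart x)]
  refine Cplx.ext rfl ?_
  have h := congrArg (fun z => (S.toLinearMap z).im) hx
  rwa [map_add, Cplx.add_im, im_map_ofReal_abs, im_map_ofReal_abs, add_zero] at h

theorem toLinearMap_eq_map_restrictReal (S : CVLHom X Y) :
    S.toLinearMap = Cplx.map S.restrictReal := by
  ext1 z
  rw [z.eq_ofReal_re_add_I_smul_ofReal_im, map_add, map_smul, map_ofReal, map_ofReal,
    ← Cplx.map_re, ← Cplx.map_im, ← Cplx.eq_ofReal_re_add_I_smul_ofReal_im,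
    ← Cplx.eq_ofReal_re_add_I_smul_ofReal_im]

theorem preservesModulus_restrictReal (S : CVLHom X Y) : PreservesModulus S.restrictReal := by
  intro z
  have h : S.toLinearMap (Cplx.ofReal z.modulus) = Cplx.ofReal (S.toLinearMap z).modulus :=
    S.map_modulus z
  rw [← S.toLinearMap_eq_map_restrictReal]
  exact congrArg Cplx.re h

/-- The composition of two homomorphisms of complex vector lattices. -/
def comp {Z : Type*} [AddCommGroup Z] [Lattice Z] [Module ℝ Z] [IsComplexVectorLattice Z]
    (S : CVLHom Y Z) (T : CVLHom X Y) : CVLHom X Z where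
  toLinearMap := S.toLinearMap ∘ₗ T.toLinearMap
  map_modulus z := (congrArg S.toLinearMap (T.map_modulus z)).trans (S.map_modulus _)

end CVLHom

section Generated

variable {X : Type*} [AddCommGroup X] [Lattice X] [Module ℝ X] [IsComplexVectorLattice X]

namespace ComplexSublattice

theorem isModulusClosed_realPart (L : ComplexSublattice X) : IsModulusClosed L.realPart :=
  fun z hre him => L.modulus_mem z (mem_iff.2 ⟨hre, him⟩)

theorem preservesModulus_subtype (L : ComplexSublattice X) :
    PreservesModulus L.realPart.subtype := by
  intro z
  have modulus_mem : (Cplx.map L.realPart.subtype z).modulus ∈ L.realPart :=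
    L.isModulusClosed_realPart z.re.2 z.im.2
  have h : IsLUB z.rotations ⟨_, modulus_mem⟩ :=
    .of_image (f := L.realPart.subtype) Iff.rfl (z.isLUB_image_rotations L.realPart.subtype)
  exact congrArg Subtype.val (z.isLUB_modulus.unique h)

/-- The complex vector sublattice `E ⊕ iE` of `X ⊕ iX`. -/
def ofRealPart (E : Submodule ℝ X) (hE : IsModulusClosed E) : ComplexSublattice X where
  carrier := {z | z.re ∈ E ∧ z.im ∈ E}
  zero_mem' := ⟨E.zero_mem, E.zero_mem⟩
  add_mem' h h' := ⟨E.add_mem h.1 h'.1, E.add_mem h.2 h'.2⟩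
  smul_mem' _ _ h := ⟨E.sub_mem (E.smul_mem _ h.1) (E.smul_mem _ h.2),
    E.add_mem (E.smul_mem _ h.2) (E.smul_mem _ h.1)⟩
  conj_mem _ h := ⟨h.1, E.neg_mem h.2⟩
  modulus_mem _ h := ⟨hE h.1 h.2, E.zero_mem⟩

end ComplexSublattice

theorem realPart_latC_le {S : Set (Cplx X)} {E : Submodule ℝ X} (hE : IsModulusClosed E)
    (hS : ∀ z ∈ S, z.re ∈ E ∧ z.im ∈ E) : (latC S).realPart ≤ E := by
  intro x hx
  have h : Cplx.ofReal x ∈ (latC S).toSubmodule := hx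
  simp only [latC, Submodule.mem_sInf] at h
  exact (h _ ⟨ComplexSublattice.ofRealPart E hE, hS, rfl⟩).1

variable {A : Type*}

/-- The members of a family in `X ⊕ iX`, as elements of the complex vector sublattice that the
family generates. -/
def latCGen (g : A → Cplx X) (a : A) : Cplx (latC (Set.range g)).realPart :=
  ComplexSublattice.mk' (g a) (subset_latC _ ⟨a, rfl⟩)

theorem eq_top_of_latCGen_mem {g : A → Cplx X} {E : Submodule ℝ (latC (Set.range g)).realPart}
    (hE : IsModulusClosed E) (hg : ∀ a, (latCGen g a).re ∈ E ∧ (latCGen g a).im ∈ E) :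
    E = ⊤ := by
  let L := latC (Set.range g)
  have hle : L.realPart ≤ E.map L.realPart.subtype := by
    refine realPart_latC_le (L.preservesModulus_subtype.isModulusClosed_map hE) ?_
    rintro _ ⟨a, rfl⟩
    exact ⟨⟨_, (hg a).1, rfl⟩, ⟨_, (hg a).2, rfl⟩⟩
  refine eq_top_iff.2 fun x _ => ?_
  obtain ⟨y, hy, hyx⟩ := hle x.2
  exact Subtype.ext hyx ▸ hy

theorem CVLHom.eq_of_eq_on_latCGen {Y : Type*} [AddCommGroup Y] [Lattice Y] [Module ℝ Y]
    [IsComplexVectorLattice Y] {g : A → Cplx X} {S T : CVLHom (latC (Set.range g)).realPart Y}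
    (h : ∀ a, S.toLinearMap (latCGen g a) = T.toLinearMap (latCGen g a)) : S = T := by
  have hreal : S.restrictReal = T.restrictReal := by
    refine LinearMap.eqLocus_eq_top.1 (eq_top_of_latCGen_mem
      (S.preservesModulus_restrictReal.isModulusClosed_eqLocus
        T.preservesModulus_restrictReal) fun a => ?_)
    have ha := h a
    rw [S.toLinearMap_eq_map_restrictReal, T.toLinearMap_eq_map_restrictReal] at ha
    exact Cplx.ext_iff.1 ha
  apply CVLHom.toLinearMap_injective
  rw [S.toLinearMap_eq_map_restrictReal, T.toLinearMap_eq_map_restrictReal, hreal]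

end Generated

section Products

section Pi

variable {I : Type*} {X : I → Type*} [∀ i, AddCommGroup (X i)] [∀ i, Lattice (X i)]
  [∀ i, Module ℝ (X i)] [∀ i, IsComplexVectorLattice (X i)]

instance : IsComplexVectorLattice (∀ i, X i) where
  exists_modulus z := ⟨fun i => (Cplx.map (LinearMap.proj i) z).modulus,
    isLUB_pi.2 fun i => z.isLUB_image_rotations (LinearMap.proj i)⟩

theorem preservesModulus_proj (i : I) :
    PreservesModulus (LinearMap.proj i : (∀ i, X i) →ₗ[ℝ] X i) :=
  preservesModulus_of_isLUB fun z => isLUB_pi.1 z.isLUB_modulus i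

end Pi

instance {R X Y : Type*} [Zero R] [Preorder R] [Zero X] [Preorder X] [SMulZeroClass R X]
    [IsOrderedModule R X] [Zero Y] [Preorder Y] [SMulZeroClass R Y] [IsOrderedModule R Y] :
    IsOrderedModule R (X × Y) where
  smul_le_smul_of_nonneg_left _ hc _ _ h :=
    ⟨smul_le_smul_of_nonneg_left h.1 hc, smul_le_smul_of_nonneg_left h.2 hc⟩
  smul_le_smul_of_nonneg_right _ ha _ _ h :=
    ⟨smul_le_smul_of_nonneg_right h ha.1, smul_le_smul_of_nonneg_right h ha.2⟩

variable {X Y : Type*} [AddCommGroup X] [Lattice X] [Module ℝ X] [IsComplexVectorLattice X]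
  [AddCommGroup Y] [Lattice Y] [Module ℝ Y] [IsComplexVectorLattice Y]

instance : IsComplexVectorLattice (X × Y) where
  exists_modulus z := ⟨((Cplx.map (.fst ℝ X Y) z).modulus, (Cplx.map (.snd ℝ X Y) z).modulus),
    isLUB_prod.2 ⟨z.isLUB_image_rotations (.fst ℝ X Y), z.isLUB_image_rotations (.snd ℝ X Y)⟩⟩

theorem preservesModulus_fst : PreservesModulus (LinearMap.fst ℝ X Y) :=
  preservesModulus_of_isLUB fun z => (isLUB_prod.1 z.isLUB_modulus).1

theorem preservesModulus_snd : PreservesModulus (LinearMap.snd ℝ X Y) :=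
  preservesModulus_of_isLUB fun z => (isLUB_prod.1 z.isLUB_modulus).2

end Products

section Terms

/-- Formal expressions in the real and imaginary parts of the elements of `A`, built with the
operations of a complex vector lattice; they bound the cardinality of the sublattice generated by a
family indexed by `A`. -/
inductive CVLTerm (A : Type u) : Type u
  | re (a : A)
  | im (a : A)
  | zero
  | add (s t : CVLTerm A)
  | smul (c : ℝ) (t : CVLTerm A)
  | modulus (s t : CVLTerm A)

variable {A : Type u} {X : Type*} [AddCommGroup X] [Lattice X] [Module ℝ X]
  [IsComplexVectorLattice X]

/-- The value of a formal expression at a family in `X ⊕ iX`. -/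
noncomputable def CVLTerm.eval (g : A → Cplx X) : CVLTerm A → X
  | re a => (g a).re
  | im a => (g a).im
  | zero => 0
  | add s t => s.eval g + t.eval g
  | smul c t => c • t.eval g
  | modulus s t => Cplx.modulus ⟨s.eval g, t.eval g⟩

theorem realPart_latC_subset_range_eval (g : A → Cplx X) :
    ((latC (Set.range g)).realPart : Set X) ⊆ Set.range (CVLTerm.eval g) := by
  let E : Submodule ℝ X :=
    { carrier := Set.range (CVLTerm.eval g)
      zero_mem' := ⟨.zero, rfl⟩
      add_mem' := by
        rintro _ _ ⟨s, rfl⟩ ⟨t, rfl⟩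
        exact ⟨.add s t, rfl⟩
      smul_mem' := by
        rintro c _ ⟨t, rfl⟩
        exact ⟨.smul c t, rfl⟩ }
  have isModulusClosed_E : IsModulusClosed E := by
    rintro ⟨_, _⟩ ⟨s, rfl⟩ ⟨t, rfl⟩
    exact ⟨.modulus s t, rfl⟩
  exact realPart_latC_le isModulusClosed_E
    (Set.forall_mem_range.2 fun a => ⟨⟨.re a, rfl⟩, ⟨.im a, rfl⟩⟩)

theorem small_realPart_latC_range (g : A → Cplx X) :
    Small.{u} (latC (Set.range g)).realPart :=
  small_subset (realPart_latC_subset_range_eval g)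

end Terms

section Transport

variable {X Y : Type*} [AddCommGroup X] [Lattice X] [Module ℝ X]
  [AddCommGroup Y] [Lattice Y] [Module ℝ Y]

theorem IsComplexVectorLattice.of_linearEquiv [IsComplexVectorLattice Y] (e : X ≃ₗ[ℝ] Y)
    (he : ∀ x y, e x ≤ e y ↔ x ≤ y) : IsComplexVectorLattice X where
  add_le_add_left x y h z := by
    rw [← he, map_add, map_add]
    exact add_le_add_left ((he x y).2 h) _
  smul_le_smul_of_nonneg_left c hc x y h := by
    rw [← he, map_smul, map_smul]
    exact smul_le_smul_of_nonneg_left ((he x y).2 h) hc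
  smul_le_smul_of_nonneg_right x hx c d h := by
    rw [← he, map_zero] at hx
    rw [← he, map_smul, map_smul]
    exact smul_le_smul_of_nonneg_right h hx
  exists_modulus z := by
    let o : X ≃o Y := ⟨e.toEquiv, he _ _⟩
    exact ⟨_, o.isLUB_image.1 (z.isLUB_image_rotations e.toLinearMap)⟩

theorem IsFreeCVL.comp_of_inverse [IsComplexVectorLattice X] [IsComplexVectorLattice Y] {A : Type*}
    {ι : A → Cplx X} (hι : IsFreeCVL.{v} ι) {S : CVLHom X Y} {R : CVLHom Y X}
    (hRS : Function.LeftInverse R.toLinearMap S.toLinearMap)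
    (hSR : Function.RightInverse R.toLinearMap S.toLinearMap) :
    IsFreeCVL.{v} fun a => S.toLinearMap (ι a) := by
  intro V _ _ _ _ T
  obtain ⟨U, hU, U_unique⟩ := hι V T
  refine ⟨U.comp R, fun a => (congrArg U.toLinearMap (hRS _)).trans (hU a), fun U' hU' => ?_⟩
  have comp_eq : U'.comp S = U := U_unique _ hU'
  refine CVLHom.toLinearMap_injective (LinearMap.ext fun z => ?_)
  rw [← comp_eq]
  exact congrArg U'.toLinearMap (hSR z).symm

end Transport

section Shrink

variable {X : Type v} [Small.{u} X] [Lattice X]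

noncomputable instance : Max (Shrink.{u} X) :=
  ⟨fun a b => equivShrink X ((equivShrink X).symm a ⊔ (equivShrink X).symm b)⟩

noncomputable instance : Min (Shrink.{u} X) :=
  ⟨fun a b => equivShrink X ((equivShrink X).symm a ⊓ (equivShrink X).symm b)⟩

noncomputable instance : Lattice (Shrink.{u} X) :=
  (equivShrink X).symm.injective.lattice _ .rfl .rfl
    (fun _ _ => Equiv.symm_apply_apply _ _) (fun _ _ => Equiv.symm_apply_apply _ _)

variable [AddCommGroup X] [Module ℝ X] [IsComplexVectorLattice X]

instance : IsComplexVectorLattice (Shrink.{u} X) :=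
  .of_linearEquiv (Shrink.linearEquiv ℝ X) (fun _ _ => Iff.rfl)

theorem IsFreeCVL.exists_shrink {A : Type*} {ι : A → Cplx X} (hι : IsFreeCVL.{w} ι) :
    ∃ κ : A → Cplx (Shrink.{u} X), IsFreeCVL.{w} κ := by
  let e := Shrink.linearEquiv.{u} ℝ X
  have e_le (x y : Shrink.{u} X) : e x ≤ e y ↔ x ≤ y := Iff.rfl
  have symm_le (x y : X) : e.symm x ≤ e.symm y ↔ x ≤ y := by
    rw [← e_le, e.apply_symm_apply, e.apply_symm_apply]
  exact ⟨_, hι.comp_of_inverse (S := (preservesModulus_of_le_iff_le symm_le).toCVLHom)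
    (R := (preservesModulus_of_le_iff_le e_le).toCVLHom)
    (fun z => Cplx.ext (e.apply_symm_apply _) (e.apply_symm_apply _))
    (fun z => Cplx.ext (e.symm_apply_apply _) (e.symm_apply_apply _))⟩

end Shrink

section Free

/-- A complex vector lattice `V ⊕ iV` with a map from `A` to it. -/
structure CVLValuation (A : Type u) : Type (max u (v + 1)) where
  carrier : Type v
  [addCommGroup : AddCommGroup carrier]
  [lattice : Lattice carrier]
  [module : Module ℝ carrier]
  [isComplexVectorLattice : IsComplexVectorLattice carrier]
  toFun : A → Cplx carrier

attribute [instance] CVLValuation.addCommGroup CVLValuation.lattice CVLValuation.module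
  CVLValuation.isComplexVectorLattice

variable (A : Type u)

/-- The tautological map from `A` to the product of all complex vector lattices in the universe `v`
with a map from `A`; it generates a free complex vector lattice. -/
def universalValuation (a : A) : Cplx (∀ i : CVLValuation.{u, v} A, i.carrier) :=
  ⟨fun i => (i.toFun a).re, fun i => (i.toFun a).im⟩

theorem isFreeCVL_latCGen_universalValuation :
    IsFreeCVL.{v} (latCGen (universalValuation.{u, v} A)) := by
  intro V _ _ _ _ T
  let i : CVLValuation.{u, v} A := ⟨V, T⟩
  let proj := (preservesModulus_proj (X := CVLValuation.carrier) i).toCVLHom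
  let incl := (ComplexSublattice.preservesModulus_subtype
    (latC (Set.range (universalValuation.{u, v} A)))).toCVLHom
  exact ⟨proj.comp incl, fun _ => rfl, fun S hS => CVLHom.eq_of_eq_on_latCGen hS⟩

theorem exists_isFreeCVL :
    ∃ (F : Type u) (_ : AddCommGroup F) (_ : Lattice F) (_ : Module ℝ F)
      (_ : IsComplexVectorLattice F) (ι : A → Cplx F), IsFreeCVL.{v} ι :=
  have := small_realPart_latC_range (universalValuation.{u, v} A)
  ⟨_, _, _, _, _, (isFreeCVL_latCGen_universalValuation.{u, v} A).exists_shrink⟩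

end Free

theorem zero_mem_convexHull_of_exists_apply_nonpos {Q : Type*} [AddCommGroup Q] [Module ℝ Q]
    {s : Set (Module.Dual ℝ Q)} (hs : s.Finite) (h : ∀ q, ∃ l ∈ s, l q ≤ 0) :
    0 ∈ convexHull ℝ s := by
  by_contra h0
  -- In the topology of pointwise convergence the continuous functionals on `Dual ℝ Q` are the
  -- evaluations at the points of `Q`.
  let B : Module.Dual ℝ Q →ₗ[ℝ] Module.Dual ℝ Q := LinearMap.id
  have : T2Space (WeakBilin B) := (WeakBilin.isEmbedding Function.injective_id).t2Space
  obtain ⟨f, c, hc, hf⟩ := geometric_hahn_banach_point_closed (E := WeakBilin B)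
    (convex_convexHull ℝ s) (hs.isClosed_convexHull (E := WeakBilin B) ℝ) h0
  obtain ⟨q, rfl⟩ := LinearMap.dualEmbedding_surjective B f
  obtain ⟨l, hl, hlq⟩ := h q
  have hlq' : 0 < l q := lt_trans hc (hf l (subset_convexHull ℝ s hl))
  exact hlq'.not_ge hlq

section LatticeSpan

theorem mapsTo_latticeClosure {F X Y : Type*} [Lattice X] [Lattice Y] [FunLike F X Y]
    [LatticeHomClass F X Y] (f : F) {s : Set X} {t : Set Y}
    (h : Set.MapsTo f s (latticeClosure t)) :
    Set.MapsTo f (latticeClosure s) (latticeClosure t) :=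
  latticeClosure_min h (isSublattice_latticeClosure.preimage f)

section

variable {X : Type*} [AddCommGroup X] [Lattice X] [IsOrderedAddMonoid X] [Module ℝ X]

theorem add_mem_latticeClosure (M : Submodule ℝ X) {x y : X} (hx : x ∈ latticeClosure (M : Set X))
    (hy : y ∈ latticeClosure (M : Set X)) : x + y ∈ latticeClosure (M : Set X) := by
  have add_mem_of_mem {m : X} (hm : m ∈ M) : m + y ∈ latticeClosure (M : Set X) :=
    mapsTo_latticeClosure (OrderIso.addLeft m)
      (fun _ hb => subset_latticeClosure (M.add_mem hm hb)) hy
  exact mapsTo_latticeClosure (OrderIso.addRight y) (fun _ hm => add_mem_of_mem hm) hx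

theorem neg_mem_latticeClosure (M : Submodule ℝ X) {x : X} (hx : x ∈ latticeClosure (M : Set X)) :
    -x ∈ latticeClosure (M : Set X) := by
  refine latticeClosure_min (t := {y | -y ∈ latticeClosure (M : Set X)})
    (fun m hm => subset_latticeClosure (M.neg_mem hm)) ?_ hx
  exact isSublattice_latticeClosure.dual.preimage (OrderIso.neg X)

variable [IsOrderedModule ℝ X]

theorem smul_mem_latticeClosure (M : Submodule ℝ X) (c : ℝ) {x : X}
    (hx : x ∈ latticeClosure (M : Set X)) : c • x ∈ latticeClosure (M : Set X) := by
  have smul_mem_of_pos {c : ℝ} (hc : 0 < c) : c • x ∈ latticeClosure (M : Set X) :=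
    mapsTo_latticeClosure (OrderIso.smulRight hc)
      (fun _ hm => subset_latticeClosure (M.smul_mem c hm)) hx
  rcases lt_trichotomy c 0 with hc | rfl | hc
  · simpa only [neg_smul, neg_neg] using
      neg_mem_latticeClosure M (smul_mem_of_pos (neg_pos.2 hc))
  · exact zero_smul ℝ x ▸ subset_latticeClosure M.zero_mem
  · exact smul_mem_of_pos hc

/-- The sublattice generated by a subspace, which is again a subspace. -/
def latticeSpan (M : Submodule ℝ X) : Submodule ℝ X where
  carrier := latticeClosure (M : Set X)
  zero_mem' := subset_latticeClosure M.zero_mem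
  add_mem' := add_mem_latticeClosure M
  smul_mem' c _ := smul_mem_latticeClosure M c

theorem le_latticeSpan (M : Submodule ℝ X) : M ≤ latticeSpan M :=
  subset_latticeClosure

theorem supClosed_latticeSpan (M : Submodule ℝ X) : SupClosed (latticeSpan M : Set X) :=
  isSublattice_latticeClosure.1

end

variable {Q V : Type*} [AddCommGroup Q] [Module ℝ Q] [AddCommGroup V] [Module ℝ V]

/-- The graph `{(l, ψ l)}` of a linear map `ψ` on the dual of `Q`, with the functionals `l` regarded
as elements of the vector lattice of all functions on `Q`. -/
def dualGraph (ψ : Module.Dual ℝ Q →ₗ[ℝ] V) : Submodule ℝ ((Q → ℝ) × V) :=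
  LinearMap.range ((LinearMap.ltoFun ℝ Q ℝ ℝ).prod ψ)

variable [Lattice V] [IsOrderedAddMonoid V] [IsOrderedModule ℝ V]

theorem inf'_nonpos_of_exists_apply_nonpos (ψ : Module.Dual ℝ Q →ₗ[ℝ] V)
    {s : Finset (Module.Dual ℝ Q)} (hs : s.Nonempty) (h : ∀ q, ∃ l ∈ s, l q ≤ 0) :
    s.inf' hs ψ ≤ 0 := by
  have hull_subset : convexHull ℝ (s : Set (Module.Dual ℝ Q)) ⊆ ψ ⁻¹' Set.Ici (s.inf' hs ψ) :=
    convexHull_min (fun _ hl => Finset.inf'_le ψ hl) ((convex_Ici _).linear_preimage ψ)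
  have h0 := hull_subset (zero_mem_convexHull_of_exists_apply_nonpos s.finite_toSet h)
  rwa [Set.mem_preimage, map_zero] at h0

theorem snd_nonpos_of_mem_latticeSpan_dualGraph {ψ : Module.Dual ℝ Q →ₗ[ℝ] V}
    {d : (Q → ℝ) × V} (hd : d ∈ latticeSpan (dualGraph ψ)) (h : d.1 ≤ 0) : d.2 ≤ 0 := by
  let _ : DistribLattice ((Q → ℝ) × V) := AddCommGroup.toDistribLattice _
  have hd' : d ∈ supClosure (infClosure (dualGraph ψ : Set ((Q → ℝ) × V))) :=
    supClosure_infClosure (dualGraph ψ : Set ((Q → ℝ) × V)) ▸ hd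
  refine supClosure_min (t := {d : (Q → ℝ) × V | d.1 ≤ 0 → d.2 ≤ 0}) ?_ ?_ hd' h
  · rintro _ ⟨t, ht, hts, rfl⟩ hle
    classical
    rw [dualGraph, LinearMap.coe_range, ← Set.image_univ, Finset.subset_set_image_iff] at hts
    obtain ⟨s, -, rfl⟩ := hts
    rw [Finset.inf'_image] at hle ⊢
    rw [Finset.apply_inf'_eq_inf'_comp _ Prod.fst fun _ _ => rfl] at hle
    rw [Finset.apply_inf'_eq_inf'_comp _ Prod.snd fun _ _ => rfl]
    refine inf'_nonpos_of_exists_apply_nonpos ψ ht.of_image fun q => ?_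
    have hq := hle q
    rwa [Finset.inf'_apply, Pi.zero_apply, Finset.inf'_le_iff] at hq
  · intro a ha b hb hab
    exact sup_le (ha (le_sup_left.trans hab)) (hb (le_sup_right.trans hab))

end LatticeSpan

section UniformClosure

variable {X : Type*} [AddCommGroup X] [Lattice X]

section

variable [IsOrderedAddMonoid X]

theorem abs_sub_le_iff_le_add_and_le_add {x y r : X} :
    |x - y| ≤ r ↔ x ≤ y + r ∧ y ≤ x + r := by
  rw [abs_le', neg_sub, sub_le_iff_le_add', sub_le_iff_le_add']

theorem abs_sub_sup'_le_of_isLUB {I : Type*} {S : Set X} {m r : X} (hm : IsLUB S m) {t : Finset I}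
    (ht : t.Nonempty) {f : I → X} (hS : ∀ x ∈ S, ∃ i ∈ t, |x - f i| ≤ r)
    (hf : ∀ i ∈ t, ∃ x ∈ S, |x - f i| ≤ r) : |m - t.sup' ht f| ≤ r := by
  refine abs_sub_le_iff_le_add_and_le_add.2
    ⟨hm.2 fun x hx => ?_, Finset.sup'_le ht f fun i hi => ?_⟩
  · obtain ⟨i, hi, hxi⟩ := hS x hx
    exact (abs_sub_le_iff_le_add_and_le_add.1 hxi).1.trans (by gcongr; exact Finset.le_sup' f hi)
  · obtain ⟨x, hx, hxi⟩ := hf i hi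
    exact (abs_sub_le_iff_le_add_and_le_add.1 hxi).2.trans (by gcongr; exact hm.1 hx)

end

variable [Module ℝ X] [IsOrderedModule ℝ X]

theorem smul_le_abs_smul_abs (c : ℝ) (x : X) : c • x ≤ |c| • |x| := by
  rcases le_total 0 c with hc | hc
  · rw [abs_of_nonneg hc]
    exact smul_le_smul_of_nonneg_left (le_abs_self x) hc
  · rw [abs_of_nonpos hc, ← neg_smul_neg]
    exact smul_le_smul_of_nonneg_left (neg_le_abs x) (neg_nonneg.2 hc)

variable [IsOrderedAddMonoid X]

theorem abs_smul_le_smul {c r : ℝ} {x b : X} (hc : |c| ≤ r) (hx : |x| ≤ b) : |c • x| ≤ r • b := by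
  have h : |c • x| ≤ |c| • |x| :=
    abs_le'.2 ⟨smul_le_abs_smul_abs c x, by
      simpa only [smul_neg, abs_neg] using smul_le_abs_smul_abs c (-x)⟩
  exact h.trans (smul_le_smul' hc hx ((abs_nonneg c).trans hc) (abs_nonneg x))

theorem IsArchimedeanVL.nonpos_of_forall_le_smul (hX : IsArchimedeanVL X) {x u : X}
    (h : ∀ ε : ℝ, 0 < ε → x ≤ ε • u) : x ≤ 0 := by
  refine hX x |u| fun n => ?_
  rcases n.eq_zero_or_pos with rfl | hn
  · simp only [zero_smul, abs_nonneg]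
  · have hn' : (0 : ℝ) < n := Nat.cast_pos.2 hn
    calc n • x = (n : ℝ) • x := (Nat.cast_smul_eq_nsmul ℝ n x).symm
      _ ≤ (n : ℝ) • (n : ℝ)⁻¹ • u := smul_le_smul_of_nonneg_left (h _ (inv_pos.2 hn')) hn'.le
      _ = u := smul_inv_smul₀ hn'.ne' u
      _ ≤ |u| := le_abs_self u

/-- The relatively uniform closure of a subspace `D`: the limits of the sequences in `D` that
converge uniformly relative to some regulator `u ∈ D`. -/
def uniformClosure (D : Submodule ℝ X) : Submodule ℝ X where
  carrier := {x | ∃ u ∈ D, ∀ ε : ℝ, 0 < ε → ∃ d ∈ D, |x - d| ≤ ε • u}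
  zero_mem' := ⟨0, D.zero_mem, fun _ _ => ⟨0, D.zero_mem, by simp⟩⟩
  add_mem' := by
    rintro x y ⟨u, hu, hx⟩ ⟨v, hv, hy⟩
    refine ⟨u + v, D.add_mem hu hv, fun ε hε => ?_⟩
    obtain ⟨d, hd, hxd⟩ := hx ε hε
    obtain ⟨e, he, hye⟩ := hy ε hε
    refine ⟨d + e, D.add_mem hd he, ?_⟩
    rw [add_sub_add_comm, smul_add]
    exact (abs_add_le _ _).trans (add_le_add hxd hye)
  smul_mem' := by
    rintro c x ⟨u, hu, hx⟩
    refine ⟨|c| • u, D.smul_mem _ hu, fun ε hε => ?_⟩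
    obtain ⟨d, hd, hxd⟩ := hx ε hε
    refine ⟨c • d, D.smul_mem c hd, ?_⟩
    rw [← smul_sub, smul_comm]
    exact abs_smul_le_smul le_rfl hxd

theorem le_uniformClosure (D : Submodule ℝ X) : D ≤ uniformClosure D :=
  fun x hx => ⟨0, D.zero_mem, fun _ _ => ⟨x, hx, by simp⟩⟩

theorem exists_dominating_regulator {D : Submodule ℝ X} (hD : SupClosed (D : Set X)) {x : X}
    (hx : x ∈ uniformClosure D) :
    ∃ u ∈ D, |x| ≤ u ∧ ∀ ε : ℝ, 0 < ε → ∃ d ∈ D, |x - d| ≤ ε • u := by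
  obtain ⟨u, hu, hx⟩ := hx
  obtain ⟨d, hd, hxd⟩ := hx 1 one_pos
  refine ⟨u + |d|, D.add_mem hu (hD hd (D.neg_mem hd)), ?_, fun ε hε => ?_⟩
  · calc |x| = |x - d + d| := by rw [sub_add_cancel]
      _ ≤ |x - d| + |d| := abs_add_le _ _
      _ ≤ u + |d| := by
        gcongr
        rwa [one_smul] at hxd
  · obtain ⟨e, he, hxe⟩ := hx ε hε
    exact ⟨e, he, hxe.trans
      (smul_le_smul_of_nonneg_left (le_add_of_nonneg_right (abs_nonneg d)) hε.le)⟩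

theorem abs_cos_sin_smul_sub_le {ε θ φ : ℝ} (hθφ : |θ - φ| ≤ ε) {x y d e u v : X}
    (hx : |x| ≤ u) (hxd : |x - d| ≤ ε • u) (hy : |y| ≤ v) (hye : |y - e| ≤ ε • v) :
    |(Real.cos θ • x + Real.sin θ • y) - (Real.cos φ • d + Real.sin φ • e)| ≤
      ε • (2 : ℝ) • (u + v) := by
  have hcos := abs_smul_le_smul ((Real.abs_cos_sub_cos_le θ φ).trans hθφ) hx
  have hsin := abs_smul_le_smul ((Real.abs_sin_sub_sin_le θ φ).trans hθφ) hy
  have hcos' := abs_smul_le_smul (Real.abs_cos_le_one φ) hxd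
  have hsin' := abs_smul_le_smul (Real.abs_sin_le_one φ) hye
  calc _ = |((Real.cos θ - Real.cos φ) • x + Real.cos φ • (x - d)) +
          ((Real.sin θ - Real.sin φ) • y + Real.sin φ • (y - e))| := by congr 1; module
    _ ≤ (|(Real.cos θ - Real.cos φ) • x| + |Real.cos φ • (x - d)|) +
          (|(Real.sin θ - Real.sin φ) • y| + |Real.sin φ • (y - e)|) :=
        (abs_add_le _ _).trans (add_le_add (abs_add_le _ _) (abs_add_le _ _))
    _ ≤ (ε • u + (1 : ℝ) • ε • u) + (ε • v + (1 : ℝ) • ε • v) := by gcongr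
    _ = ε • (2 : ℝ) • (u + v) := by module

theorem isModulusClosed_uniformClosure {X : Type*} [AddCommGroup X] [Lattice X] [Module ℝ X]
    [IsComplexVectorLattice X] {D : Submodule ℝ X} (hD : SupClosed (D : Set X)) :
    IsModulusClosed (uniformClosure D) := by
  intro z hre him
  obtain ⟨u, hu, hreu, hre⟩ := exists_dominating_regulator hD hre
  obtain ⟨v, hv, himv, him⟩ := exists_dominating_regulator hD him
  refine ⟨(2 : ℝ) • (u + v), D.smul_mem _ (D.add_mem hu hv), fun ε hε => ?_⟩
  obtain ⟨d, hd, hred⟩ := hre ε hε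
  obtain ⟨e, he, hime⟩ := him ε hε
  obtain ⟨t, htI, hcover⟩ := (isCompact_Icc (a := 0) (b := 2 * Real.pi)).elim_nhds_subcover
    (Metric.ball · ε) fun θ _ => Metric.ball_mem_nhds θ hε
  have exists_near {θ : ℝ} (hθ : θ ∈ Set.Icc 0 (2 * Real.pi)) : ∃ φ ∈ t, |θ - φ| < ε := by
    simpa only [Set.mem_iUnion, exists_prop, Metric.mem_ball, Real.dist_eq] using hcover hθ
  have ht : t.Nonempty :=
    (exists_near (Set.left_mem_Icc.2 Real.two_pi_pos.le)).imp fun _ h => h.1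
  refine ⟨t.sup' ht fun φ => Real.cos φ • d + Real.sin φ • e,
    hD.finsetSup'_mem ht fun φ _ => D.add_mem (D.smul_mem _ hd) (D.smul_mem _ he),
    abs_sub_sup'_le_of_isLUB z.isLUB_modulus ht ?_ fun φ hφ => ?_⟩
  · rintro _ ⟨θ, hθ, rfl⟩
    obtain ⟨φ, hφ, hθφ⟩ := exists_near hθ
    exact ⟨φ, hφ, abs_cos_sin_smul_sub_le hθφ.le hreu hred himv hime⟩
  · refine ⟨_, ⟨φ, htI φ hφ, rfl⟩, abs_cos_sin_smul_sub_le ?_ hreu hred himv hime⟩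
    rw [sub_self, abs_zero]
    exact hε.le

variable {Q : Type*} [AddCommGroup Q] [Module ℝ Q]

theorem snd_nonpos_of_mem_uniformClosure_dualGraph (hX : IsArchimedeanVL X)
    {ψ : Module.Dual ℝ Q →ₗ[ℝ] X} {w : (Q → ℝ) × X}
    (hw : w ∈ uniformClosure (latticeSpan (dualGraph ψ))) (h : w.1 ≤ 0) : w.2 ≤ 0 := by
  obtain ⟨u, hu, hw⟩ := hw
  refine hX.nonpos_of_forall_le_smul (u := (2 : ℝ) • u.2) fun ε hε => ?_
  obtain ⟨d, hd, hwd⟩ := hw ε hε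
  obtain ⟨hwd, hdw⟩ := abs_sub_le_iff_le_add_and_le_add.1 hwd
  have hdu : (d - ε • u).1 ≤ 0 :=
    sub_nonpos.2 (hdw.1.trans (add_le_of_nonpos_left h))
  have hd' : d.2 ≤ ε • u.2 := sub_nonpos.1 (snd_nonpos_of_mem_latticeSpan_dualGraph
    (Submodule.sub_mem _ hd (Submodule.smul_mem _ ε hu)) hdu)
  calc w.2 ≤ d.2 + ε • u.2 := hwd.2
    _ ≤ ε • u.2 + ε • u.2 := by gcongr
    _ = ε • (2 : ℝ) • u.2 := by module

theorem snd_eq_zero_of_mem_uniformClosure_dualGraph (hX : IsArchimedeanVL X)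
    {ψ : Module.Dual ℝ Q →ₗ[ℝ] X} {w : (Q → ℝ) × X}
    (hw : w ∈ uniformClosure (latticeSpan (dualGraph ψ))) (h : w.1 = 0) : w.2 = 0 := by
  refine le_antisymm (snd_nonpos_of_mem_uniformClosure_dualGraph hX hw h.le) (neg_nonpos.1 ?_)
  exact snd_nonpos_of_mem_uniformClosure_dualGraph hX (Submodule.neg_mem _ hw)
    (neg_nonpos.2 h.ge)

end UniformClosure

section FreeArchimedean

section Graph

variable {A X Y : Type*} [AddCommGroup X] [Lattice X] [Module ℝ X] [IsComplexVectorLattice X]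
  [AddCommGroup Y] [Lattice Y] [Module ℝ Y] [IsComplexVectorLattice Y]

theorem preservesModulus_of_graph_subset {E : Type*} [AddCommGroup E] [Lattice E] [Module ℝ E]
    [IsComplexVectorLattice E] {j : E →ₗ[ℝ] X} (hj : PreservesModulus j) {h : E →ₗ[ℝ] Y}
    {G : Submodule ℝ (X × Y)} (hG : IsModulusClosed G) (hG₀ : ∀ w ∈ G, w.1 = 0 → w.2 = 0)
    (hjh : ∀ x, (j x, h x) ∈ G) : PreservesModulus h := by
  intro z
  have modulus_mem : (Cplx.map (j.prod h) z).modulus ∈ G := hG (hjh z.re) (hjh z.im)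
  refine sub_eq_zero.1 (hG₀ _ (G.sub_mem (hjh z.modulus) modulus_mem) ?_) |>.trans
    (preservesModulus_snd _)
  exact sub_eq_zero.2 ((hj z).trans (preservesModulus_fst (Cplx.map (j.prod h) z)).symm)

theorem exists_cvlHom_of_graph {p : A → Cplx (X × Y)}
    (hp : ∀ w ∈ (latC (Set.range p)).realPart, w.1 = 0 → w.2 = 0) :
    ∃ S : CVLHom (latC (Set.range fun a => Cplx.map (.fst ℝ X Y) (p a))).realPart Y,
      ∀ a, S.toLinearMap (latCGen _ a) = Cplx.map (.snd ℝ X Y) (p a) := by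
  let G := (latC (Set.range p)).realPart
  let L := latC (Set.range fun a => Cplx.map (.fst ℝ X Y) (p a))
  have hG : IsModulusClosed G := ComplexSublattice.isModulusClosed_realPart _
  have hpG (a : A) : (p a).re ∈ G ∧ (p a).im ∈ G :=
    ComplexSublattice.mem_iff.1 (subset_latC _ ⟨a, rfl⟩)
  have hL : L.realPart ≤ G.map (.fst ℝ X Y) := by
    refine realPart_latC_le (preservesModulus_fst.isModulusClosed_map hG) ?_
    rintro _ ⟨a, rfl⟩
    exact ⟨⟨_, (hpG a).1, rfl⟩, ⟨_, (hpG a).2, rfl⟩⟩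
  let h : L.realPart →ₗ[ℝ] Y := G.toLinearPMap.toFun ∘ₗ Submodule.inclusion hL
  have hh (x : L.realPart) : ((x : X), h x) ∈ G :=
    G.mem_graph_toLinearPMap hp (Submodule.inclusion hL x)
  have h_eq {x : L.realPart} {w : X × Y} (hw : w ∈ G) (hx : (x : X) = w.1) : h x = w.2 :=
    sub_eq_zero.1 (hp _ (G.sub_mem (hh x) hw) (sub_eq_zero.2 hx))
  have h_modulus : PreservesModulus h :=
    preservesModulus_of_graph_subset L.preservesModulus_subtype hG hp hh
  exact ⟨h_modulus.toCVLHom, fun a => Cplx.ext (h_eq (hpG a).1 rfl) (h_eq (hpG a).2 rfl)⟩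

end Graph

theorem isArchimedeanVL_pi_real (K : Type*) : IsArchimedeanVL (K → ℝ) := by
  intro x y h k
  by_contra! hk
  obtain ⟨n, hn⟩ := exists_lt_nsmul hk (y k)
  exact hn.not_ge (h n k)

theorem IsArchimedeanVL.realPart {X : Type*} [AddCommGroup X] [Lattice X] [Module ℝ X]
    [IsComplexVectorLattice X] (hX : IsArchimedeanVL X) (L : ComplexSublattice X) :
    IsArchimedeanVL L.realPart :=
  fun x y h => hX x y h

theorem exists_linearMap_apply_eq {K M V I : Type*} [DivisionRing K] [AddCommGroup M] [Module K M]
    [AddCommGroup V] [Module K V] {b : I → M} (hb : LinearIndependent K b) (f : I → V) :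
    ∃ ψ : M →ₗ[K] V, ∀ i, ψ (b i) = f i := by
  obtain ⟨ψ, hψ⟩ := ((Module.Basis.span hb).constr ℕ f).exists_extend
  refine ⟨ψ, fun i => ?_⟩
  rw [← (Module.Basis.span hb).constr_basis ℕ f i, ← hψ, LinearMap.comp_apply,
    Submodule.subtype_apply, Module.Basis.span_apply]

variable {A Q : Type*} [AddCommGroup Q] [Module ℝ Q]

theorem isFreeArchimedeanCVL_latCGen {φ : A → Cplx (Module.Dual ℝ Q)}
    (hφ : LinearIndependent ℝ (Sum.elim (fun a => (φ a).re) fun a => (φ a).im)) :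
    IsFreeArchimedeanCVL.{v} (latCGen fun a => Cplx.map (LinearMap.ltoFun ℝ Q ℝ ℝ) (φ a)) := by
  refine ⟨(isArchimedeanVL_pi_real Q).realPart _, fun V _ _ _ _ hV T => ?_⟩
  obtain ⟨ψ, hψ⟩ := exists_linearMap_apply_eq hφ (Sum.elim (fun a => (T a).re) fun a => (T a).im)
  let p (a : A) : Cplx ((Q → ℝ) × V) := Cplx.map ((LinearMap.ltoFun ℝ Q ℝ ℝ).prod ψ) (φ a)
  have le_closure : dualGraph ψ ≤ uniformClosure (latticeSpan (dualGraph ψ)) :=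
    (le_latticeSpan _).trans (le_uniformClosure _)
  have realPart_le :
      (latC (Set.range p)).realPart ≤ uniformClosure (latticeSpan (dualGraph ψ)) := by
    refine realPart_latC_le (isModulusClosed_uniformClosure (supClosed_latticeSpan _)) ?_
    rintro _ ⟨a, rfl⟩
    exact ⟨le_closure ⟨_, rfl⟩, le_closure ⟨_, rfl⟩⟩
  obtain ⟨S, hS⟩ := exists_cvlHom_of_graph (p := p) fun w hw =>
    snd_eq_zero_of_mem_uniformClosure_dualGraph hV (realPart_le hw)
  have hS' (a : A) : S.toLinearMap (latCGen _ a) = T a :=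
    (hS a).trans (Cplx.ext (hψ (.inl a)) (hψ (.inr a)))
  exact ⟨S, hS', fun S' hSA => CVLHom.eq_of_eq_on_latCGen fun a => (hSA a).trans (hS' a).symm⟩

theorem linearIndependent_proj (R K : Type*) [CommRing R] :
    LinearIndependent R fun k : K => (LinearMap.proj k : (K → R) →ₗ[R] R) := by
  classical
  exact .of_pairwise_dual_eq_zero_one _ (fun k => Module.Dual.eval R _ (Pi.single k 1))
    (fun _ _ hkl => Pi.single_eq_of_ne hkl.symm 1) fun k => Pi.single_eq_same k 1

theorem isFreeArchimedeanCVL_fvlIota {A : Type u} :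
    IsFreeArchimedeanCVL.{v} (fvlIota : A → Cplx (fvlC A).realPart) := by
  let φ (a : A) : Cplx (Module.Dual ℝ (Signed A × Signed A → ℝ)) :=
    ⟨LinearMap.proj (.inl a, .inl a), LinearMap.proj (.inr a, .inl a)⟩
  let coordinate : A ⊕ A → Signed A × Signed A :=
    Sum.elim (fun a => (.inl a, .inl a)) fun a => (.inr a, .inl a)
  have coordinate_injective : coordinate.Injective := by
    rintro (a | a) (b | b) h <;> simp_all [coordinate]
  have parts_eq : (Sum.elim (fun a => (φ a).re) fun a => (φ a).im) =
      (fun k => LinearMap.proj k) ∘ coordinate :=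
    funext (Sum.rec (fun _ => rfl) fun _ => rfl)
  have hφ : LinearIndependent ℝ (Sum.elim (fun a => (φ a).re) fun a => (φ a).im) :=
    parts_eq ▸ (linearIndependent_proj ℝ (Signed A × Signed A)).comp _ coordinate_injective
  have genElem_eq : (fun a => Cplx.map (LinearMap.ltoFun ℝ _ ℝ ℝ) (φ a)) = genElem := rfl
  have h := isFreeArchimedeanCVL_latCGen.{v} hφ
  rw [genElem_eq] at h
  exact h

end FreeArchimedean

theorem mainTheorem11 (A : Type u) [Nonempty A] :
    (∃ (F : Type u) (_ : AddCommGroup F) (_ : Lattice F) (_ : Module ℝ F)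
        (_ : IsComplexVectorLattice F) (ι : A → Cplx F), IsFreeCVL.{v} ι) ∧
      IsFreeArchimedeanCVL.{v} (fvlIota : A → Cplx (fvlC A).realPart) := by
  exact ⟨exists_isFreeCVL A, isFreeArchimedeanCVL_fvlIota⟩
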